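/- Let $d\ge 2$ and $n\ge 1$ be integers and let $0\le\Phi^+\le d$. Let $$\rho(\Phi^+)=\frac{d}{d^2-1}\left[(d-\Phi^+)\frac{\mathbb I}{d^2}+\Big(\Phi^+-\frac1d\Big)|\Phi^+\rangle\langle\Phi^+|\right],\qquad |\Phi^+\rangle=\frac{1}{\sqrt d}\sum_{i=1}^d|ii\rangle ,$$ be the isotropic state on $\mathbb C^d\otimes\mathbb C^d$ with parameter $\Phi^+$. A density operator $\rho$ on $\mathcal H_L\otimes\mathcal H_R$ is called $1$-$n$ sharable if there is a density operator $w$ on $\mathcal H_L\otimes\mathcal H_R^{\otimes n}$ such that, for every $j=1,\dots,n$, the partial trace of $w$ over all the factors $\mathcal H_R$ except the $j$-th one is equal to $\rho$. Then $\rho(\Phi^+)$ is $1$-$n$ sharable if and only if $$\Phi^+\le 1+\frac{d-1}{n}.$$ -/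

import Mathlib

open scoped ComplexOrder

noncomputable section

/-- A density matrix: positive semidefinite with unit trace. -/
def IsDensityMatrix {ι : Type*} [Fintype ι] (ρ : Matrix ι ι ℂ) : Prop :=
  ρ.PosSemidef ∧ ρ.trace = 1

/-- The partial trace of an operator `w` on `H_L^{⊗ m} ⊗ H_R^{⊗ n}` over all tensor factors except
the `i`-th left one and the `j`-th right one. Here `H_L = ℂ^α`, `H_R = ℂ^β`, and the product basis
of the total space is indexed by the pairs `(x, y)` with `x : Fin m → α`, `y : Fin n → β`. The
`((a, b), (a', b'))` entry is the sum of the entries of `w` whose row index `(x, y)` has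
`x i = a`, `y j = b`, and whose column index has `a'`, `b'` at these two places and agrees with the
row index at all other places. -/
def reducedState {α β : Type*} [Fintype α] [DecidableEq α] [Fintype β] [DecidableEq β] {m n : ℕ}
    (w : Matrix ((Fin m → α) × (Fin n → β)) ((Fin m → α) × (Fin n → β)) ℂ)
    (i : Fin m) (j : Fin n) : Matrix (α × β) (α × β) ℂ :=
  fun r c => ∑ x : Fin m → α, ∑ y : Fin n → β,
    if x i = r.1 ∧ y j = r.2 then
      w (x, y) (Function.update x i c.1, Function.update y j c.2)
    else 0

/-- A bipartite state `ρ` on `ℂ^α ⊗ ℂ^β` is `m`-`n` sharable if there is a density matrix on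
`(ℂ^α)^{⊗ m} ⊗ (ℂ^β)^{⊗ n}` all of whose left-right pair reductions are equal to `ρ`. -/
def IsSharable {α β : Type*} [Fintype α] [DecidableEq α] [Fintype β] [DecidableEq β]
    (m n : ℕ) (ρ : Matrix (α × β) (α × β) ℂ) : Prop :=
  ∃ w : Matrix ((Fin m → α) × (Fin n → β)) ((Fin m → α) × (Fin n → β)) ℂ,
    IsDensityMatrix w ∧ ∀ (i : Fin m) (j : Fin n), reducedState w i j = ρ

/-- The maximally entangled vector `|Φ⁺⟩ = √(1/d) ∑ₖ |kk⟩`. -/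
def maxEntangledKet (d : ℕ) : Fin d × Fin d → ℂ :=
  fun p => if p.1 = p.2 then (Real.sqrt (1 / d) : ℂ) else 0

/-- The isotropic operator with parameter `Φ`,
`d / (d² - 1) * [(d - Φ) * 𝟙 / d² + (Φ - 1/d) * |Φ⁺⟩⟨Φ⁺|]`;
for `d ≥ 2` it is a state exactly when `0 ≤ Φ ≤ d`. -/
def isotropicState (d : ℕ) (Φ : ℝ) : Matrix (Fin d × Fin d) (Fin d × Fin d) ℂ :=
  ((d : ℂ) / ((d : ℂ) ^ 2 - 1)) •
    ((((d : ℂ) - Φ) / (d : ℂ) ^ 2) • (1 : Matrix (Fin d × Fin d) (Fin d × Fin d) ℂ) +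
      ((Φ : ℂ) - 1 / d) • Matrix.vecMulVec (maxEntangledKet d) (star (maxEntangledKet d)))

end

open Matrix Finset
open scoped MatrixOrder

/-! Let `P_j` be `pairOperator d n j`, `H = ∑ P_j` and `c = n + d - 1`. Any extension `w` of the
isotropic state satisfies `tr (w P_j) = Φ` for each `j`, so `tr (w H) = n Φ`, and necessity is the
operator bound `H ≤ c` (`sum_pairOperator_bound`). With `S_jk` the swap of two right factors, the
positive operators `(1 - S_jk) P_j (1 - S_jk)ᴴ` add up to `2 (c H - H²)`, which confines the
spectrum of `H` to `[0, c]`.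

For sufficiency, each unit vector `b` gives two extreme extensions. `cloningVector` is `H` applied
to `b̄ ⊗ b^{⊗ n}`, an eigenvector of `H` with the top eigenvalue `c`, hence with `Φ = c / n = 1 + (d
- 1) / n`. `orthogonalExtension` is annihilated by `H`, hence has `Φ = 0`. Averaging over `b` makes
the reductions isotropic, and mixing the two averages reaches every intermediate `Φ`. The reductions
depend on `b` only through moments of order at most two, so a finite weighted 2-design replaces the
Haar average. -/

theorem Matrix.PosSemidef.trace_mul_nonneg {ι : Type*} [Fintype ι] [DecidableEq ι]
    {A B : Matrix ι ι ℂ} (hA : A.PosSemidef) (hB : B.PosSemidef) : 0 ≤ (A * B).trace := by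
  obtain ⟨C, rfl⟩ := CStarAlgebra.nonneg_iff_eq_star_mul_self.mp hA.nonneg
  rw [Matrix.mul_assoc, Matrix.trace_mul_comm]
  exact (hB.mul_mul_conjTranspose_same C).trace_nonneg

theorem sum_fin_one_arrow {d : ℕ} {M : Type*} [AddCommMonoid M] (f : (Fin 1 → Fin d) → M) :
    ∑ x, f x = ∑ a, f (fun _ => a) :=
  Fintype.sum_equiv (Equiv.funUnique (Fin 1) (Fin d)) _ _ fun x => by
    congr 1; funext i; simp [Subsingleton.elim i 0]

theorem update_fin_one {d : ℕ} (x : Fin 1 → Fin d) (i : Fin 1) (c : Fin d) :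
    Function.update x i c = fun _ => c := by
  funext k; simp [Subsingleton.elim k i]

/-- The basis of `ℂ^d ⊗ (ℂ^d)^{⊗ n}`. -/
abbrev PairIndex (d n : ℕ) : Type := (Fin 1 → Fin d) × (Fin n → Fin d)

/-- The operator `d |Φ⁺⟩⟨Φ⁺|` on the left factor and the `j`-th right factor. -/
def pairOperator (d n : ℕ) (j : Fin n) : Matrix (PairIndex d n) (PairIndex d n) ℂ :=
  fun p q => if p.1 0 = p.2 j ∧ q.2 = Function.update p.2 j (q.1 0) then 1 else 0

/-- The operator permuting the `j`-th and the `k`-th right factors. -/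
def swapOperator (d n : ℕ) (j k : Fin n) : Matrix (PairIndex d n) (PairIndex d n) ℂ :=
  fun p q => if q = (p.1, p.2 ∘ Equiv.swap j k) then 1 else 0

/-! ### Algebra of pair and swap operators, and the spectral bound. -/

section Operators

variable {d n : ℕ}

theorem pairOperator_mulVec (j : Fin n) (v : PairIndex d n → ℂ) (p : PairIndex d n) :
    (pairOperator d n j *ᵥ v) p =
      if p.1 0 = p.2 j then ∑ a, v (fun _ => a, Function.update p.2 j a) else 0 := by
  simp only [mulVec, dotProduct, pairOperator, Fintype.sum_prod_type, sum_fin_one_arrow]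
  by_cases h : p.1 0 = p.2 j <;> simp [h]

theorem swapOperator_mulVec (j k : Fin n) (v : PairIndex d n → ℂ) (p : PairIndex d n) :
    (swapOperator d n j k *ᵥ v) p = v (p.1, p.2 ∘ Equiv.swap j k) := by
  simp [mulVec, dotProduct, swapOperator]

theorem pairOperator_isHermitian (j : Fin n) : (pairOperator d n j).IsHermitian := by
  have key : ∀ p q : PairIndex d n, (p.1 0 = p.2 j ∧ q.2 = Function.update p.2 j (q.1 0)) →
      (q.1 0 = q.2 j ∧ p.2 = Function.update q.2 j (p.1 0)) := by
    rintro p q ⟨h1, h2⟩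
    refine ⟨by rw [h2]; simp, ?_⟩
    rw [h2, h1]; simp
  ext p q
  have := (⟨key p q, key q p⟩ : _ ↔ _)
  simp only [conjTranspose_apply, pairOperator, this]
  split_ifs <;> simp

theorem swapOperator_isHermitian (j k : Fin n) : (swapOperator d n j k).IsHermitian := by
  have key : ∀ p q : PairIndex d n, q = (p.1, p.2 ∘ Equiv.swap j k) →
      p = (q.1, q.2 ∘ Equiv.swap j k) := by
    rintro p q rfl
    ext <;> simp
  ext p q
  have := (⟨key p q, key q p⟩ : _ ↔ _)
  simp only [conjTranspose_apply, swapOperator, this]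
  split_ifs <;> simp

theorem pairOperator_mul_self (j : Fin n) :
    pairOperator d n j * pairOperator d n j = (d : ℂ) • pairOperator d n j := by
  refine Matrix.ext_iff_mulVec.mpr fun v => ?_
  ext p
  simp only [← mulVec_mulVec, smul_mulVec, Pi.smul_apply, smul_eq_mul, pairOperator_mulVec]
  split_ifs <;> simp

/-- This is the teleportation identity: contracting the left factor with place `j` after creating a
maximally entangled pair at `k` merely moves the content of one right place to the other. -/
theorem pairOperator_mul_of_ne {j k : Fin n} (h : j ≠ k) :
    pairOperator d n j * pairOperator d n k = pairOperator d n j * swapOperator d n j k := by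
  refine Matrix.ext_iff_mulVec.mpr fun v => ?_
  ext p
  simp only [← mulVec_mulVec, pairOperator_mulVec, swapOperator_mulVec]
  split_ifs with hp
  · simp only [Function.update_of_ne h.symm, Finset.sum_ite_eq', Finset.mem_univ, if_true]
    refine Finset.sum_congr rfl fun a _ => ?_
    congr 2
    funext l
    rcases eq_or_ne l j with rfl | hj
    · simp [h, h.symm]
    rcases eq_or_ne l k with rfl | hk
    · simp
    · simp [hj, hk, Equiv.swap_apply_of_ne_of_ne]
  · rfl

theorem swapOperator_mul_self (j k : Fin n) :
    swapOperator d n j k * swapOperator d n j k = 1 := by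
  refine Matrix.ext_iff_mulVec.mpr fun v => ?_
  ext p
  simp only [← mulVec_mulVec, swapOperator_mulVec, one_mulVec]
  congr 1
  ext <;> simp

theorem pairOperator_mul_swapOperator (j k : Fin n) :
    pairOperator d n j * swapOperator d n j k = swapOperator d n j k * pairOperator d n k := by
  refine Matrix.ext_iff_mulVec.mpr fun v => ?_
  ext p
  simp only [← mulVec_mulVec, pairOperator_mulVec, swapOperator_mulVec, Function.comp_apply,
    Equiv.swap_apply_right]
  split_ifs
  · refine Finset.sum_congr rfl fun a _ => ?_
    congr 2
    funext l
    rcases eq_or_ne l j with rfl | hj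
    · rcases eq_or_ne l k with rfl | hk
      · simp
      · simp [hk, hk.symm]
    rcases eq_or_ne l k with rfl | hk
    · simp
    · simp [hj, hk, Equiv.swap_apply_of_ne_of_ne]
  · rfl

theorem swapOperator_comm (j k : Fin n) : swapOperator d n j k = swapOperator d n k j := by
  unfold swapOperator; rw [Equiv.swap_comm]

theorem pairOperator_posSemidef [NeZero d] (j : Fin n) : (pairOperator d n j).PosSemidef := by
  have h := (posSemidef_conjTranspose_mul_self (pairOperator d n j)).smul
    (inv_nonneg.mpr (Nat.cast_nonneg (α := ℂ) d))
  have hd : (d : ℂ) ≠ 0 := NeZero.ne _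
  rwa [(pairOperator_isHermitian j).eq, pairOperator_mul_self, smul_smul,
    inv_mul_cancel₀ hd, one_smul] at h

/-- The conjugation of `pairOperator` by `1 - swapOperator`. -/
theorem one_sub_swapOperator_conj (j k : Fin n) :
    (1 - swapOperator d n j k) * pairOperator d n j * (1 - swapOperator d n j k)ᴴ =
      pairOperator d n j + pairOperator d n k - pairOperator d n j * pairOperator d n k
        - pairOperator d n k * pairOperator d n j
        + if j = k then (2 * (d : ℂ) - 2) • pairOperator d n j else 0 := by
  rw [(isHermitian_one.sub (swapOperator_isHermitian j k)).eq]
  split_ifs with h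
  -- For `j = k` the conjugation is zero, while `P_j² = d P_j` makes the four main terms `(2 - 2d)
  -- P_j`. The correction cancels this, so that the double sum can run over all pairs.
  · subst h
    have hS : swapOperator d n j j = 1 := by
      refine Matrix.ext_iff_mulVec.mpr fun v => ?_
      ext p
      simp [swapOperator_mulVec]
    rw [hS, pairOperator_mul_self]
    simp only [sub_self, Matrix.mul_zero]
    module
  · have h1 := pairOperator_mul_of_ne (d := d) h
    have h2 := pairOperator_mul_of_ne (d := d) (Ne.symm h)
    rw [swapOperator_comm, ← swapOperator_comm k j, pairOperator_mul_swapOperator,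
      swapOperator_comm k j] at h2
    have h3 : swapOperator d n j k * pairOperator d n j * swapOperator d n j k =
        pairOperator d n k := by
      rw [Matrix.mul_assoc, pairOperator_mul_swapOperator, ← Matrix.mul_assoc,
        swapOperator_mul_self, Matrix.one_mul]
    rw [h1, h2, add_zero]
    simp only [Matrix.sub_mul, Matrix.mul_sub, Matrix.one_mul, Matrix.mul_one, h3]
    abel

/-- The bound `H ≤ c` is stated after multiplication by `c`, because `c² - c H = (c - H)² + (c H -
H²)` is then visibly a sum of two positive operators. -/
theorem sum_pairOperator_bound [NeZero d] :
    (((n + d - 1 : ℂ) * (n + d - 1 : ℂ)) • (1 : Matrix (PairIndex d n) (PairIndex d n) ℂ)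
      - (n + d - 1 : ℂ) • ∑ j, pairOperator d n j).PosSemidef := by
  set H := ∑ j, pairOperator d n j with hH
  set c : ℂ := n + d - 1 with hc
  have hHh : H.IsHermitian := by
    rw [hH, IsHermitian, conjTranspose_sum]
    exact Finset.sum_congr rfl fun j _ => pairOperator_isHermitian j
  have hR : (∑ j, ∑ k, (1 - swapOperator d n j k) * pairOperator d n j *
      (1 - swapOperator d n j k)ᴴ).PosSemidef :=
    posSemidef_sum _ fun j _ => posSemidef_sum _ fun k _ =>
      (pairOperator_posSemidef j).mul_mul_conjTranspose_same _
  have hsum : ∑ j, ∑ k, (1 - swapOperator d n j k) * pairOperator d n j *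
      (1 - swapOperator d n j k)ᴴ = (2 * c) • H - (2 : ℂ) • (H * H) := by
    simp only [one_sub_swapOperator_conj, Finset.sum_add_distrib, Finset.sum_sub_distrib,
      Finset.sum_const, Finset.card_univ, Fintype.card_fin, Finset.sum_ite_eq, Finset.mem_univ,
      if_true, ← Finset.smul_sum, ← Finset.mul_sum, ← Finset.sum_mul, ← hH]
    rw [← Nat.cast_smul_eq_nsmul ℂ, hc]
    module
  have hcs : star c = c := by simp [hc]
  have hsq : ((c • (1 : Matrix (PairIndex d n) (PairIndex d n) ℂ) - H)ᴴ *
      (c • (1 : Matrix (PairIndex d n) (PairIndex d n) ℂ) - H)).PosSemidef :=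
    posSemidef_conjTranspose_mul_self _
  have := hsq.add (hR.smul (inv_nonneg.mpr (zero_le_two (α := ℂ))))
  convert this using 1
  rw [hsum, conjTranspose_sub, conjTranspose_smul, hHh.eq, hcs, conjTranspose_one]
  simp only [Matrix.sub_mul, Matrix.mul_sub, Matrix.smul_mul, Matrix.mul_smul, Matrix.one_mul,
    Matrix.mul_one]
  module

theorem trace_mul_pairOperator (w : Matrix (PairIndex d n) (PairIndex d n) ℂ) (j : Fin n) :
    (w * pairOperator d n j).trace = ∑ a, ∑ c, reducedState w 0 j (a, a) (c, c) := by
  rw [← (pairOperator_isHermitian j).eq]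
  simp only [trace, diag_apply, Matrix.mul_apply, reducedState, pairOperator, conjTranspose_apply,
    Fintype.sum_prod_type, sum_fin_one_arrow, update_fin_one, ite_and, apply_ite star, star_one,
    star_zero, mul_ite, mul_one, mul_zero, Finset.sum_ite_eq',
    Finset.mem_univ, if_true, Finset.sum_ite_irrel, Finset.sum_const_zero]
  refine Finset.sum_congr rfl fun a _ => ?_
  rw [Finset.sum_comm]
  refine Finset.sum_congr rfl fun y _ => ?_
  simp only [eq_comm (a := a)]
  split_ifs <;> simp

theorem trace_reducedState (w : Matrix (PairIndex d n) (PairIndex d n) ℂ) (j : Fin n) :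
    (reducedState w 0 j).trace = w.trace := by
  simp only [trace, diag_apply, reducedState, Fintype.sum_prod_type, update_fin_one,
    sum_fin_one_arrow, ite_and, Finset.sum_ite_irrel, Finset.sum_const_zero, Finset.sum_ite_eq',
    Finset.mem_univ, if_true]
  refine Finset.sum_congr rfl fun a _ => ?_
  rw [Finset.sum_comm]
  refine Finset.sum_congr rfl fun y _ => ?_
  simp

end Operators

/-! ### Isotropic states and necessity. -/

theorem isotropicState_apply {d : ℕ} (Φ : ℝ) (a c a' c' : Fin d) :
    isotropicState d Φ (a, c) (a', c') = (d : ℂ) / ((d : ℂ) ^ 2 - 1) *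
      ((d - Φ) / (d : ℂ) ^ 2 * ((if a = a' then 1 else 0) * (if c = c' then 1 else 0)) +
        (Φ - 1 / d) * ((1 / d) * ((if a = c then 1 else 0) * (if a' = c' then 1 else 0)))) := by
  have h : ((Real.sqrt (1 / d) : ℝ) : ℂ) * (Real.sqrt (1 / d) : ℝ) = 1 / d := by
    rw [← Complex.ofReal_mul, Real.mul_self_sqrt (by positivity)]
    simp
  simp only [isotropicState, Matrix.smul_apply, Matrix.add_apply, smul_eq_mul, vecMulVec_apply,
    maxEntangledKet, Pi.star_apply, Matrix.one_apply, Prod.mk.injEq]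
  congr 3
  · split_ifs <;> simp_all
  · rw [← h]
    split_ifs <;> simp

theorem sum_isotropicState_diagonal {d : ℕ} (hd : 2 ≤ d) (Φ : ℝ) :
    ∑ a, ∑ c, isotropicState d Φ (a, a) (c, c) = Φ := by
  have h0 : (d : ℂ) ≠ 0 := by exact_mod_cast (by lia : d ≠ 0)
  have h1 : (d : ℂ) ^ 2 - 1 ≠ 0 := by
    have : d ^ 2 ≠ 1 := by nlinarith
    exact sub_ne_zero.mpr (by exact_mod_cast this)
  simp only [isotropicState_apply, ← Finset.mul_sum, Finset.sum_add_distrib, if_true, mul_one,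
    ← ite_and, mul_ite, mul_zero, and_self, Finset.sum_ite_eq, Finset.mem_univ, Finset.sum_const,
    Finset.card_univ, Fintype.card_fin, nsmul_eq_mul]
  field_simp
  ring

theorem trace_isotropicState {d : ℕ} (hd : 2 ≤ d) (Φ : ℝ) : (isotropicState d Φ).trace = 1 := by
  have h0 : (d : ℂ) ≠ 0 := by exact_mod_cast (by lia : d ≠ 0)
  have h1 : (d : ℂ) ^ 2 - 1 ≠ 0 := by
    have : d ^ 2 ≠ 1 := by nlinarith
    exact sub_ne_zero.mpr (by exact_mod_cast this)
  simp only [trace, diag_apply, Fintype.sum_prod_type, isotropicState_apply, ← Finset.mul_sum,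
    Finset.sum_add_distrib, if_true, mul_one, mul_ite, mul_zero,
    Finset.sum_ite_eq, Finset.mem_univ, Finset.sum_const,
    Finset.card_univ, Fintype.card_fin, nsmul_eq_mul]
  field_simp
  ring

theorem IsSharable.isotropicState_le {d n : ℕ} (hd : 2 ≤ d) (hn : 1 ≤ n) {Φ : ℝ}
    (h : IsSharable 1 n (isotropicState d Φ)) : Φ ≤ 1 + ((d : ℝ) - 1) / n := by
  obtain ⟨w, ⟨hw, htr⟩, hred⟩ := h
  have : NeZero d := ⟨by lia⟩
  have hpos := hw.trace_mul_nonneg sum_pairOperator_bound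
  have hn0 : (0 : ℝ) < n := by exact_mod_cast hn
  have hd0 : (2 : ℝ) ≤ d := by exact_mod_cast hd
  simp only [Matrix.mul_sub, Matrix.mul_smul, Matrix.mul_one, trace_sub, trace_smul, htr,
    Finset.mul_sum, trace_sum, trace_mul_pairOperator, hred, sum_isotropicState_diagonal hd,
    Finset.sum_const, Finset.card_univ, Fintype.card_fin, smul_eq_mul, nsmul_eq_mul] at hpos
  have hpos' : (0 : ℝ) ≤ (n + d - 1) * (n + d - 1) * 1 - (n + d - 1) * (n * Φ) := by
    exact_mod_cast hpos
  have hc : (0 : ℝ) < n + d - 1 := by linarith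
  have : (0 : ℝ) ≤ (n + d - 1) - n * Φ := by
    by_contra! hlt
    nlinarith [mul_neg_of_pos_of_neg hc hlt]
  rw [← sub_nonneg, show 1 + ((d : ℝ) - 1) / n - Φ = ((n + d - 1) - n * Φ) / n by
    field_simp; ring]
  positivity

/-! ### Pair reductions of the two extensions attached to a unit vector. -/

section Reductions

variable {d n : ℕ}

theorem reducedState_add (w w' : Matrix (PairIndex d n) (PairIndex d n) ℂ) (j : Fin n) :
    reducedState (w + w') 0 j = reducedState w 0 j + reducedState w' 0 j := by
  ext r c
  simp only [reducedState, Matrix.add_apply, ← Finset.sum_add_distrib]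
  refine Finset.sum_congr rfl fun x _ => Finset.sum_congr rfl fun y _ => ?_
  split_ifs <;> simp

theorem reducedState_smul (z : ℂ) (w : Matrix (PairIndex d n) (PairIndex d n) ℂ) (j : Fin n) :
    reducedState (z • w) 0 j = z • reducedState w 0 j := by
  ext r c
  simp only [reducedState, Matrix.smul_apply, Finset.smul_sum]
  refine Finset.sum_congr rfl fun x _ => Finset.sum_congr rfl fun y _ => ?_
  split_ifs <;> simp

theorem reducedState_sum {ι : Type*} (s : Finset ι)
    (w : ι → Matrix (PairIndex d n) (PairIndex d n) ℂ) (j : Fin n) :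
    reducedState (∑ i ∈ s, w i) 0 j = ∑ i ∈ s, reducedState (w i) 0 j := by
  classical
  induction s using Finset.induction_on with
  | empty => ext r c; simp [reducedState]
  | insert i s hi ih => rw [Finset.sum_insert hi, Finset.sum_insert hi, reducedState_add, ih]

/-- The reduction of an operator whose entries are products over the right factors. -/
theorem reducedState_of_prod (w : Matrix (PairIndex d n) (PairIndex d n) ℂ)
    (K : Fin d → Fin d → ℂ) (G : Fin d → Fin d → Fin n → Fin d → Fin d → ℂ)
    (hw : ∀ p q, w p q = K (p.1 0) (q.1 0) * ∏ i, G (p.1 0) (q.1 0) i (p.2 i) (q.2 i))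
    (j : Fin n) (a c a' c' : Fin d) :
    reducedState w 0 j (a, c) (a', c') =
      K a a' * (G a a' j c c' * ∏ i ∈ univ.erase j, ∑ z, G a a' i z z) := by
  -- The constraint at place `j` is absorbed into the `j`-th factor, so that the sum over `y`
  -- becomes a product of one-place sums.
  have hprod : ∀ y : Fin n → Fin d,
      (if y j = c then ∏ i, G a a' i (y i) (Function.update y j c' i) else 0) =
        ∏ i, (if i = j then (if y i = c then G a a' j c c' else 0) else G a a' i (y i) (y i)) := by
    intro y
    rw [← Finset.mul_prod_erase univ (fun i => ite (i = j) _ _) (Finset.mem_univ j),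
      ← Finset.mul_prod_erase univ (fun i => G a a' i (y i) _) (Finset.mem_univ j)]
    simp only [if_true, Function.update_self]
    split_ifs with h
    · rw [h]
      congr 1
      refine Finset.prod_congr rfl fun i hi => ?_
      simp [Finset.ne_of_mem_erase hi]
    · simp
  have hsum : ∑ y : Fin n → Fin d,
      (if y j = c then ∏ i, G a a' i (y i) (Function.update y j c' i) else 0) =
        G a a' j c c' * ∏ i ∈ univ.erase j, ∑ z, G a a' i z z := by
    simp only [hprod]
    rw [← Fintype.piFinset_univ, ← Finset.prod_univ_sum (fun _ => univ)
      (fun i z => if i = j then (if z = c then G a a' j c c' else 0) else G a a' i z z),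
      ← Finset.mul_prod_erase univ _ (Finset.mem_univ j)]
    congr 1
    · simp
    · refine Finset.prod_congr rfl fun i hi => ?_
      simp [Finset.ne_of_mem_erase hi]
  simp only [reducedState, sum_fin_one_arrow, update_fin_one, hw, ite_and,
    Finset.sum_ite_irrel, Finset.sum_const_zero, Finset.sum_ite_eq', Finset.mem_univ, if_true]
  rw [← hsum, Finset.mul_sum]
  refine Finset.sum_congr rfl fun y _ => ?_
  simp only [mul_ite, mul_zero]

/-- The operator `(1 - |b̄⟩⟨b̄|) ⊗ |b⟩⟨b|^{⊗ n}`. -/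
def orthogonalExtension (n : ℕ) (b : Fin d → ℂ) : Matrix (PairIndex d n) (PairIndex d n) ℂ :=
  kroneckerMap (· * ·)
    (1 - vecMulVec (fun x : Fin 1 → Fin d => star (b (x 0))) (fun x : Fin 1 → Fin d => b (x 0)))
    (vecMulVec (fun y : Fin n → Fin d => ∏ i, b (y i)) (star fun y => ∏ i, b (y i)))

/-- The vector `∑ₗ ∑ₐ |a⟩ ⊗ |b ⋯ b a b ⋯ b⟩` with `a` at the `l`-th right place. -/
def cloningVector (n : ℕ) (b : Fin d → ℂ) : PairIndex d n → ℂ :=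
  fun p => ∑ l, ∏ i, if i = l then (if p.2 i = p.1 0 then 1 else 0) else b (p.2 i)

/-- For a unit vector the left factor `1 - M` is an orthogonal projection, hence equal to `(1 - M)ᴴ
(1 - M)`. -/
theorem orthogonalExtension_posSemidef (b : Fin d → ℂ) (hb : ∑ a, b a * star (b a) = 1) :
    (orthogonalExtension n b).PosSemidef := by
  refine PosSemidef.kronecker ?_ (posSemidef_vecMulVec_self_star _)
  set M := vecMulVec (fun x : Fin 1 → Fin d => star (b (x 0))) (fun x : Fin 1 → Fin d => b (x 0)) with hM
  have h1 : Mᴴ = M := by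
    ext x y; simp [hM, vecMulVec_apply, mul_comm]
  have h2 : M * M = M := by
    rw [hM, vecMulVec_mul_vecMulVec]
    simp only [dotProduct, sum_fin_one_arrow, hb, one_smul]
  have := posSemidef_conjTranspose_mul_self (1 - M)
  rw [conjTranspose_sub, conjTranspose_one, h1] at this
  simpa only [Matrix.sub_mul, Matrix.mul_sub, h2, Matrix.one_mul, Matrix.mul_one, sub_self,
    sub_zero] using this

theorem reducedState_orthogonalExtension (b : Fin d → ℂ) (hb : ∑ a, b a * star (b a) = 1)
    (j : Fin n) (a c a' c' : Fin d) :
    reducedState (orthogonalExtension n b) 0 j (a, c) (a', c') =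
      ((if a = a' then 1 else 0) - star (b a) * b a') * (b c * star (b c')) := by
  rw [reducedState_of_prod (orthogonalExtension n b)
    (fun a a' => (if a = a' then 1 else 0) - star (b a) * b a')
    (fun _ _ _ z z' => b z * star (b z'))]
  · simp only [hb, Finset.prod_const_one, mul_one]
  · rintro ⟨x, y⟩ ⟨x', y'⟩
    have : x = x' ↔ x 0 = x' 0 := by
      rw [funext_iff]; simp
    simp [orthogonalExtension, kroneckerMap_apply, vecMulVec_apply, Matrix.one_apply, this,
      Finset.prod_mul_distrib]

theorem reducedState_cloningVector (b : Fin d → ℂ) (hb : ∑ a, b a * star (b a) = 1)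
    (j : Fin n) (a c a' c' : Fin d) :
    reducedState (vecMulVec (cloningVector n b) (star (cloningVector n b))) 0 j (a, c) (a', c') =
      ((if a = c then 1 else 0) + (n - 1) * (b c * star (b a))) *
          ((if a' = c' then 1 else 0) + (n - 1) * (star (b c') * b a')) +
        (n - 1) * (b c * star (b c') * ((if a = a' then 1 else 0) - star (b a) * b a')) := by
  have hw : vecMulVec (cloningVector n b) (star (cloningVector n b)) =
      ∑ l, ∑ m, Matrix.of fun p q : PairIndex d n =>
        (∏ i, if i = l then (if p.2 i = p.1 0 then 1 else 0) else b (p.2 i)) *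
        (∏ i, if i = m then (if q.2 i = q.1 0 then 1 else 0) else star (b (q.2 i))) := by
    ext p q
    simp only [vecMulVec_apply, cloningVector, Pi.star_apply, star_sum, star_prod,
      Finset.sum_mul_sum, Matrix.sum_apply, Matrix.of_apply, apply_ite star, star_one, star_zero]
  -- The cross terms factor into a part from `l` and a part from `m`, except when `l = m ≠ j`:
  -- tracing out place `l` then yields `δ_{aa'}` instead of `b̄_a b_{a'}`, and the last summand is
  -- the difference.
  have hlm : ∀ l m, reducedState (Matrix.of fun p q : PairIndex d n =>
        (∏ i, if i = l then (if p.2 i = p.1 0 then 1 else 0) else b (p.2 i)) *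
        (∏ i, if i = m then (if q.2 i = q.1 0 then 1 else 0) else star (b (q.2 i))))
          0 j (a, c) (a', c') =
      (if l = j then (if a = c then 1 else 0) else b c * star (b a)) *
        (if m = j then (if a' = c' then 1 else 0) else star (b c') * b a') +
      if l = m then (if l = j then 0 else
        b c * star (b c') * ((if a = a' then 1 else 0) - star (b a) * b a')) else 0 := by
    intro l m
    rw [reducedState_of_prod _ (fun _ _ => 1)
      (fun a a' i z z' => (if i = l then (if z = a then 1 else 0) else b z) *
        (if i = m then (if z' = a' then 1 else 0) else star (b z')))
      (fun p q => by simp only [Matrix.of_apply, one_mul, Finset.prod_mul_distrib])]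
    rw [one_mul]
    by_cases hlm : l = m
    · subst hlm
      have hT : ∀ i, ∑ z, (if i = l then (if z = a then (1 : ℂ) else 0) else b z) *
          (if i = l then (if z = a' then 1 else 0) else star (b z)) =
          if i = l then (if a = a' then 1 else 0) else 1 := by
        intro i
        by_cases h : i = l
        · simp [h, eq_comm]
        · simp only [h, if_false, hb]
      simp only [hT, Finset.prod_ite_eq', Finset.mem_erase, Finset.mem_univ, and_true, if_true]
      by_cases hj : l = j
      · subst hj; simp [eq_comm]
      · simp only [hj, Ne.symm hj, if_false, ne_eq, not_false_eq_true, if_true]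
        ring
    · have hT : ∀ i, ∑ z, (if i = l then (if z = a then (1 : ℂ) else 0) else b z) *
          (if i = m then (if z = a' then 1 else 0) else star (b z)) =
          (if i = l then star (b a) else 1) * (if i = m then b a' else 1) := by
        intro i
        split_ifs with h h' <;> simp_all
      simp only [hT, Finset.prod_mul_distrib, Finset.prod_ite_eq', Finset.mem_erase,
        Finset.mem_univ, and_true, hlm, if_false, add_zero, eq_comm (a := j),
        eq_comm (a := c), eq_comm (a := c'), ne_eq, ite_not]
      split_ifs <;> simp_all <;> ring
  have hcount : ∀ x y : ℂ, ∑ l : Fin n, (if l = j then x else y) = x + (n - 1) * y := by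
    intro x y
    have : ∀ l : Fin n, (if l = j then x else y) = y + if l = j then x - y else 0 := by
      intro l; split_ifs <;> simp
    simp only [this, Finset.sum_add_distrib, Finset.sum_ite_eq', Finset.mem_univ, if_true,
      Finset.sum_const, Finset.card_univ, Fintype.card_fin, nsmul_eq_mul]
    ring
  rw [hw]
  simp only [reducedState_sum, Matrix.sum_apply, hlm, Finset.sum_add_distrib,
    Finset.sum_ite_eq, Finset.mem_univ, if_true, ← Finset.mul_sum, ← Finset.sum_mul, hcount]
  ring

end Reductions

/-! ### Weighted projective 2-designs and an explicit finite one. -/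

/-- A finite weighted family of unit vectors has the second-moment property of a complex
projective 2-design. -/
structure IsWeightedTwoDesign {d : ℕ} {κ : Type*} [Fintype κ] (p : κ → ℝ) (b : κ → Fin d → ℂ) :
    Prop where
  nonneg : ∀ s, 0 ≤ p s
  unit : ∀ s, ∑ a, b s a * star (b s a) = 1
  moment : ∀ i i' k k', ∑ s, (p s : ℂ) * (star (b s i) * b s i' * (b s k * star (b s k'))) =
    ((if i = i' then 1 else 0) * (if k = k' then 1 else 0) +
      (if i = k then 1 else 0) * (if i' = k' then 1 else 0)) / (d * (d + 1))

/-- Contracting one `b`, `b̄` pair of the second moment with `∑ |b_l|² = 1` leaves the first moment.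
-/
theorem IsWeightedTwoDesign.first_moment {d : ℕ} {κ : Type*} [Fintype κ] {p : κ → ℝ}
    {b : κ → Fin d → ℂ} (h : IsWeightedTwoDesign p b) (i k : Fin d) :
    ∑ s, (p s : ℂ) * (star (b s i) * b s k) = (if i = k then 1 else 0) / d := by
  have hd : (d : ℂ) ≠ 0 := by
    have := i.pos; exact_mod_cast this.ne'
  have hd1 : (d : ℂ) + 1 ≠ 0 := by exact_mod_cast d.succ_ne_zero
  calc ∑ s, (p s : ℂ) * (star (b s i) * b s k)
      = ∑ l, ∑ s, (p s : ℂ) * (star (b s i) * b s k * (b s l * star (b s l))) := by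
        rw [Finset.sum_comm]
        refine Finset.sum_congr rfl fun s _ => ?_
        simp only [← Finset.mul_sum, h.unit s, mul_one]
    _ = _ := by
        simp only [h.moment, ← Finset.sum_div, Finset.sum_add_distrib, if_true, mul_one,
          Finset.sum_const, Finset.card_univ, Fintype.card_fin, nsmul_eq_mul, ← ite_and,
          mul_ite, mul_zero]
        by_cases hik : i = k
        · subst hik; simp
          field_simp
        · have : ∀ l, ¬ (k = l ∧ i = l) := fun l hl => hik (hl.2.trans hl.1.symm)
          simp [hik, this]

/-- Products of independent uniformly distributed fourth roots of unity are uncorrelated unless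
they are balanced. -/
theorem sum_phases (d : ℕ) (i i' k k' : Fin d) :
    ∑ f : Fin d → Fin 4, star (Complex.I ^ (f i : ℕ)) * Complex.I ^ (f i' : ℕ) *
      (Complex.I ^ (f k : ℕ) * star (Complex.I ^ (f k' : ℕ))) =
    if (i = i' ∧ k = k') ∨ (i = k ∧ i' = k') then (4 : ℂ) ^ d else 0 := by
  have hI : ∀ m : ℕ, star (Complex.I ^ m) * Complex.I ^ m = 1 := by
    intro m
    rw [star_pow, ← mul_pow]; simp
  split_ifs with h
  · have : ∀ f : Fin d → Fin 4, star (Complex.I ^ (f i : ℕ)) * Complex.I ^ (f i' : ℕ) *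
      (Complex.I ^ (f k : ℕ) * star (Complex.I ^ (f k' : ℕ))) = 1 := by
      intro f
      rcases h with ⟨rfl, rfl⟩ | ⟨rfl, rfl⟩
      · rw [hI, mul_comm (Complex.I ^ _), hI, one_mul]
      · rw [mul_mul_mul_comm, hI, mul_comm (Complex.I ^ _), hI, one_mul]
    simp only [this, Finset.sum_const, Finset.card_univ, Fintype.card_fun, Fintype.card_fin,
      nsmul_eq_mul, mul_one]
    norm_num
  · set g : Fin d → Fin 4 → ℂ := fun t z =>
      (if t = i then star (Complex.I ^ (z : ℕ)) else 1) *
      (if t = i' then Complex.I ^ (z : ℕ) else 1) *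
      ((if t = k then Complex.I ^ (z : ℕ) else 1) *
      (if t = k' then star (Complex.I ^ (z : ℕ)) else 1)) with hg
    have hprod : ∀ f : Fin d → Fin 4, star (Complex.I ^ (f i : ℕ)) * Complex.I ^ (f i' : ℕ) *
      (Complex.I ^ (f k : ℕ) * star (Complex.I ^ (f k' : ℕ))) = ∏ t, g t (f t) := by
      intro f
      simp only [hg, Finset.prod_mul_distrib, Finset.prod_ite_eq', Finset.mem_univ, if_true]
    simp only [hprod]
    rw [← Fintype.piFinset_univ, ← Finset.prod_univ_sum (fun _ => univ) g]
    have h3 : Complex.I ^ 3 = -Complex.I := by rw [pow_succ, Complex.I_sq]; ring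
    -- Each case picks a coordinate whose net exponent of `I` is `±1` or `±2`. It is not a multiple
    -- of 4, so the sum over the fourth roots of unity vanishes.
    have hz : ∃ t, ∑ z, g t z = 0 := by
      by_cases h1 : i ≠ i' ∧ i ≠ k
      · refine ⟨i, ?_⟩
        simp only [hg, Fin.sum_univ_four, h1.1, h1.2, if_true, if_false]
        split_ifs <;> simp [h3]
      by_cases h2 : k' ≠ i' ∧ k' ≠ k
      · refine ⟨k', ?_⟩
        simp only [hg, Fin.sum_univ_four, h2.1, h2.2, if_true, if_false]
        split_ifs <;> simp [h3]
      by_cases h4 : i = i'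
      · refine ⟨k, ?_⟩
        have h5 : k ≠ k' := fun e => h (Or.inl ⟨h4, e⟩)
        have h6 : k' = i' := by by_contra e; exact h2 ⟨e, h5.symm⟩
        have h7 : k ≠ i' := h6 ▸ h5
        simp [hg, Fin.sum_univ_four, h4, h5, h7, h3]
      · refine ⟨i', ?_⟩
        have h5 : i = k := by by_contra e; exact h1 ⟨h4, e⟩
        have h6 : i' ≠ k' := fun e => h (Or.inr ⟨h5, e⟩)
        have h7 : k' = k := by by_contra e; exact h2 ⟨h6.symm, e⟩
        have h8 : i' ≠ k := h7 ▸ h6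
        simp [hg, Fin.sum_univ_four, Ne.symm h4, h6, h8, h3]
    obtain ⟨t, ht⟩ := hz
    exact Finset.prod_eq_zero (Finset.mem_univ t) ht

/-- The weights `1 / (d (d + 1))` on the basis vectors, and the total weight `d / (d + 1)` on the
flat vectors. -/
noncomputable def designWeight (d : ℕ) : Fin d ⊕ (Fin d → Fin 4) → ℝ :=
  Sum.elim (fun _ => 1 / (d * (d + 1))) (fun _ => d / ((d + 1) * 4 ^ d))

/-- The basis vectors of `ℂ^d`, and the flat vectors whose phases are fourth roots of unity. -/
noncomputable def designVector (d : ℕ) : Fin d ⊕ (Fin d → Fin 4) → Fin d → ℂ :=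
  Sum.elim (fun l => Pi.single l 1) (fun f a => (Real.sqrt (1 / d) : ℂ) * Complex.I ^ (f a : ℕ))

/-- The flat vectors give both pairings of the indices but count the case of four equal indices once
instead of twice; the basis vectors supply exactly the missing term. -/
theorem isWeightedTwoDesign_designVector {d : ℕ} [NeZero d] :
    IsWeightedTwoDesign (designWeight d) (designVector d) := by
  have hd : (d : ℂ) ≠ 0 := NeZero.ne _
  have hd1 : (d : ℂ) + 1 ≠ 0 := by exact_mod_cast d.succ_ne_zero
  have hr : ((Real.sqrt (1 / d) : ℝ) : ℂ) * (Real.sqrt (1 / d) : ℝ) = 1 / d := by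
    rw [← Complex.ofReal_mul, Real.mul_self_sqrt (by positivity)]
    simp
  have hrs : star ((Real.sqrt (1 / d) : ℝ) : ℂ) = (Real.sqrt (1 / d) : ℝ) := Complex.conj_ofReal _
  refine ⟨?_, ?_, ?_⟩
  · rintro (l | f) <;> simp only [designWeight, Sum.elim_inl, Sum.elim_inr] <;> positivity
  · rintro (l | f)
    · simp [designVector, Pi.single_apply]
    · have : ∀ m : ℕ, (((Real.sqrt (1 / d) : ℝ) : ℂ) * Complex.I ^ m) *
          star (((Real.sqrt (1 / d) : ℝ) : ℂ) * Complex.I ^ m) = 1 / d := by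
        intro m
        rw [star_mul', hrs, mul_mul_mul_comm, hr, star_pow, ← mul_pow]
        simp
      simp only [designVector, Sum.elim_inr, this]
      simp [hd]
  · intro i i' k k'
    have hflat : ∀ f : Fin d → Fin 4,
        star (designVector d (Sum.inr f) i) * designVector d (Sum.inr f) i' *
          (designVector d (Sum.inr f) k * star (designVector d (Sum.inr f) k')) =
        (1 / d * (1 / d)) * (star (Complex.I ^ (f i : ℕ)) * Complex.I ^ (f i' : ℕ) *
          (Complex.I ^ (f k : ℕ) * star (Complex.I ^ (f k' : ℕ)))) := by
      intro f
      simp only [designVector, Sum.elim_inr, star_mul', hrs, ← hr]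
      ring
    have hbasis : ∑ l : Fin d, star (designVector d (Sum.inl l) i) *
          designVector d (Sum.inl l) i' *
          (designVector d (Sum.inl l) k * star (designVector d (Sum.inl l) k')) =
        if (i = i' ∧ k = k') ∧ (i = k ∧ i' = k') then 1 else 0 := by
      rw [Finset.sum_eq_single i]
      · have hiff : ((i = i' ∧ k = k') ∧ (i = k ∧ i' = k')) ↔ (i' = i ∧ k = i ∧ k' = i) := by
          grind
        simp only [designVector, Sum.elim_inl, Pi.single_apply, hiff]
        by_cases h1 : i' = i <;> by_cases h2 : k = i <;> by_cases h3 : k' = i <;> simp [h1, h2, h3]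
      · intro l _ hl
        simp [designVector, Pi.single_apply, hl.symm]
      · simp
    rw [Fintype.sum_sum_type]
    simp only [designWeight, Sum.elim_inl, Sum.elim_inr, hflat, ← Finset.mul_sum, sum_phases,
      hbasis]
    push_cast
    rw [ite_zero_mul_ite_zero, ite_zero_mul_ite_zero, mul_one]
    by_cases hA : i = i' ∧ k = k' <;> by_cases hB : i = k ∧ i' = k'
    · rw [if_pos ⟨hA, hB⟩, if_pos (Or.inl hA), if_pos hA, if_pos hB]
      field_simp
    · rw [if_neg fun h => hB h.2, if_pos (Or.inl hA), if_pos hA, if_neg hB]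
      field_simp
      ring
    · rw [if_neg fun h => hA h.1, if_pos (Or.inr hB), if_neg hA, if_pos hB]
      field_simp
    · rw [if_neg fun h => hA h.1, if_neg (not_or.mpr ⟨hA, hB⟩), if_neg hA, if_neg hB]
      ring

/-! ### Averages of the two extensions over a 2-design. -/

namespace IsWeightedTwoDesign

variable {d n : ℕ} {κ : Type*} [Fintype κ] {p : κ → ℝ} {b : κ → Fin d → ℂ}

theorem reducedState_sum_orthogonalExtension (h : IsWeightedTwoDesign p b) (j : Fin n)
    (a c a' c' : Fin d) :
    reducedState (∑ s, (p s : ℂ) • orthogonalExtension n (b s)) 0 j (a, c) (a', c') =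
      (d * ((if a = a' then 1 else 0) * (if c = c' then 1 else 0)) -
        (if a = c then 1 else 0) * (if a' = c' then 1 else 0)) / (d * (d + 1)) := by
  have hd : (d : ℂ) ≠ 0 := by
    have := a.pos; exact_mod_cast this.ne'
  have hd1 : (d : ℂ) + 1 ≠ 0 := by exact_mod_cast d.succ_ne_zero
  have key : reducedState (∑ s, (p s : ℂ) • orthogonalExtension n (b s)) 0 j (a, c) (a', c') =
      (if a = a' then 1 else 0) * (∑ s, (p s : ℂ) * (star (b s c') * b s c)) -
        ∑ s, (p s : ℂ) * (star (b s a) * b s a' * (b s c * star (b s c'))) := by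
    rw [reducedState_sum, Matrix.sum_apply, Finset.mul_sum, ← Finset.sum_sub_distrib]
    refine Finset.sum_congr rfl fun s _ => ?_
    rw [reducedState_smul, Matrix.smul_apply, reducedState_orthogonalExtension _ (h.unit s),
      smul_eq_mul]
    ring
  rw [key]
  simp only [h.first_moment, h.moment, eq_comm (a := c')]
  field_simp
  ring

theorem reducedState_sum_cloningVector (h : IsWeightedTwoDesign p b) (hp : ∑ s, p s = 1)
    (j : Fin n) (a c a' c' : Fin d) :
    reducedState (∑ s, (p s : ℂ) • vecMulVec (cloningVector n (b s))
        (star (cloningVector n (b s)))) 0 j (a, c) (a', c') =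
      ((n - 1) * (n + d - 1) * ((if a = a' then 1 else 0) * (if c = c' then 1 else 0)) +
        (d * (d + 1) + 2 * (n - 1) * (d + 1) + (n - 1) * (n - 2)) *
          ((if a = c then 1 else 0) * (if a' = c' then 1 else 0))) / (d * (d + 1)) := by
  have hd : (d : ℂ) ≠ 0 := by
    have := a.pos; exact_mod_cast this.ne'
  have hd1 : (d : ℂ) + 1 ≠ 0 := by exact_mod_cast d.succ_ne_zero
  have hp' : ∑ s, (p s : ℂ) = 1 := by exact_mod_cast hp
  have key : reducedState (∑ s, (p s : ℂ) • vecMulVec (cloningVector n (b s))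
        (star (cloningVector n (b s)))) 0 j (a, c) (a', c') =
      (if a = c then 1 else 0) * (if a' = c' then 1 else 0) * ∑ s, (p s : ℂ) +
      (n - 1) * (if a' = c' then 1 else 0) * (∑ s, (p s : ℂ) * (star (b s a) * b s c)) +
      (n - 1) * (if a = c then 1 else 0) * (∑ s, (p s : ℂ) * (star (b s c') * b s a')) +
      (n - 1) * (if a = a' then 1 else 0) * (∑ s, (p s : ℂ) * (star (b s c') * b s c)) +
      (n - 1) * (n - 2) *
        ∑ s, (p s : ℂ) * (star (b s a) * b s a' * (b s c * star (b s c'))) := by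
    rw [reducedState_sum, Matrix.sum_apply]
    simp only [Finset.mul_sum, ← Finset.sum_add_distrib]
    refine Finset.sum_congr rfl fun s _ => ?_
    rw [reducedState_smul, Matrix.smul_apply, reducedState_cloningVector _ (h.unit s),
      smul_eq_mul]
    ring
  rw [key, hp']
  simp only [h.first_moment, h.moment, eq_comm (a := c')]
  field_simp
  ring

theorem sum_weight [NeZero d] (h : IsWeightedTwoDesign p b) : ∑ s, p s = 1 := by
  have hd : (d : ℂ) ≠ 0 := NeZero.ne _
  have : ∑ i, ∑ s, (p s : ℂ) * (star (b s i) * b s i) = ∑ s, (p s : ℂ) := by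
    rw [Finset.sum_comm]
    refine Finset.sum_congr rfl fun s _ => ?_
    simp only [← Finset.mul_sum, mul_comm (star _), h.unit s, mul_one]
  simp only [h.first_moment, if_true, Finset.sum_const, Finset.card_univ, Fintype.card_fin,
    nsmul_eq_mul, mul_one_div_cancel hd] at this
  exact_mod_cast this.symm

end IsWeightedTwoDesign

/-! ### Sufficiency and the equivalence. -/

theorem isSharable_of_posSemidef {d n : ℕ} (hn : 1 ≤ n)
    {ρ : Matrix (Fin d × Fin d) (Fin d × Fin d) ℂ} (hρ : ρ.trace = 1)
    {w : Matrix (PairIndex d n) (PairIndex d n) ℂ} (hw : w.PosSemidef)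
    (hred : ∀ j, reducedState w 0 j = ρ) : IsSharable 1 n ρ := by
  refine ⟨w, ⟨hw, ?_⟩, fun i j => Subsingleton.elim 0 i ▸ hred j⟩
  rw [← trace_reducedState w ⟨0, hn⟩, hred, hρ]

theorem isSharable_isotropicState {d n : ℕ} (hd : 2 ≤ d) (hn : 1 ≤ n) {Φ : ℝ} (hΦ0 : 0 ≤ Φ)
    (hΦ : Φ ≤ 1 + ((d : ℝ) - 1) / n) : IsSharable 1 n (isotropicState d Φ) := by
  have : NeZero d := ⟨by lia⟩
  have hn0 : (0 : ℝ) < n := by exact_mod_cast hn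
  have hd0 : (2 : ℝ) ≤ d := by exact_mod_cast hd
  have hc : (0 : ℝ) < n + d - 1 := by linarith
  have hdes := isWeightedTwoDesign_designVector (d := d)
  set p := designWeight d
  set b := designVector d
  -- The cloning part has squared norm `n c` and parameter `c / n`, so it must carry probability `Φ
  -- n / c`; dividing by `n c` gives `lam`. The remaining probability divided by the trace `d - 1`
  -- of `orthogonalExtension` gives `mu`; the hypothesis on `Φ` says exactly that it is nonnegative.
  set lam : ℝ := Φ / (n + d - 1) ^ 2 with hlam
  set mu : ℝ := (1 - Φ * n / (n + d - 1)) / (d - 1) with hmu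
  have hlam0 : 0 ≤ lam := by positivity
  have hmu0 : 0 ≤ mu := by
    refine div_nonneg ?_ (by linarith)
    rw [sub_nonneg, div_le_one hc]
    have := mul_le_mul_of_nonneg_right hΦ hn0.le
    rw [add_mul, div_mul_cancel₀ _ hn0.ne'] at this
    linarith
  have hp : ∀ s, (0 : ℂ) ≤ (p s : ℂ) := fun s => Complex.zero_le_real.mpr (hdes.nonneg s)
  refine isSharable_of_posSemidef (w :=
    (lam : ℂ) • (∑ s, (p s : ℂ) • vecMulVec (cloningVector n (b s)) (star (cloningVector n (b s))))
      + (mu : ℂ) • (∑ s, (p s : ℂ) • orthogonalExtension n (b s)))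
    hn (trace_isotropicState hd Φ) ?_ fun j => ?_
  · refine .add (.smul (posSemidef_sum _ fun s _ => .smul ?_ (hp s))
      (Complex.zero_le_real.mpr hlam0)) (.smul (posSemidef_sum _ fun s _ => .smul ?_ (hp s))
      (Complex.zero_le_real.mpr hmu0))
    · exact posSemidef_vecMulVec_self_star _
    · exact orthogonalExtension_posSemidef _ (hdes.unit s)
  · ext ⟨a, c⟩ ⟨a', c'⟩
    have h0 : (d : ℂ) ≠ 0 := NeZero.ne _
    have h1 : (d : ℂ) + 1 ≠ 0 := by exact_mod_cast d.succ_ne_zero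
    have h2 : (d : ℂ) - 1 ≠ 0 := by
      rw [sub_ne_zero]; exact_mod_cast (by lia : d ≠ 1)
    have h3 : (n : ℂ) + d - 1 ≠ 0 := by exact_mod_cast hc.ne'
    rw [reducedState_add, reducedState_smul, reducedState_smul, Matrix.add_apply,
      Matrix.smul_apply, Matrix.smul_apply, hdes.reducedState_sum_cloningVector hdes.sum_weight,
      hdes.reducedState_sum_orthogonalExtension, isotropicState_apply, hlam, hmu,
      show (d : ℂ) ^ 2 - 1 = (d - 1) * (d + 1) by ring]
    push_cast
    simp only [smul_eq_mul]
    -- Both sides are combinations of the same two tensors, the identity `X` and the unnormalised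
    -- maximally entangled projector `Y`, so only a rational identity in the coefficients remains.
    generalize (if a = a' then (1 : ℂ) else 0) * (if c = c' then 1 else 0) = X
    generalize (if a = c then (1 : ℂ) else 0) * (if a' = c' then 1 else 0) = Y
    field_simp
    ring

/-- An isotropic state of two qudits with parameter `Φ` is `1`-`n` sharable iff
`Φ ≤ 1 + (d - 1) / n`. -/
theorem mainTheorem8 (d n : ℕ) (hd : 2 ≤ d) (hn : 1 ≤ n) (Φ : ℝ) (hΦ0 : 0 ≤ Φ)
    (hΦd : Φ ≤ (d : ℝ)) :
    IsSharable 1 n (isotropicState d Φ) ↔ Φ ≤ 1 + ((d : ℝ) - 1) / (n : ℝ) :=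
  ⟨fun h => h.isotropicState_le hd hn, fun h => isSharable_isotropicState hd hn hΦ0 h⟩
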